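/- Let $A$ be a finite alphabet and let $M$ be a normal nondeterministic finite automaton over $A$. Thus $M$ is given by a finite directed graph $\Gamma(M)$ (multiple edges allowed) whose vertices are the states and whose edges, forming the finite set $E$, are labelled by elements of $A$, together with a nonempty set of start states and a set of accept states; normality means that there is at least one accept state, that $\Gamma(M)$ has at least one edge, and that $\Gamma(M)$ is strongly connected (any state can be reached from any state by a directed edge-path). Let $\Omega$ be the space of semi-infinite directed edge-paths $\omega=e_1,e_2,\dots$ in $\Gamma(M)$, with the $\sigma$-algebra generated by cylinder sets. For a probability distribution $\mu$ on $E$ let $P_\mu$ be the probability measure on $\Omega$ given by the Markov chain on $E$ with initial distribution $\mu$ and transition probabilities $p_{e,f}=1/m$ if the origin of $f$ is the terminus of $e$, where $m$ is the number of edges going out of the terminus of $e$, and $p_{e,f}=0$ otherwise; that is, $P_\mu$ gives the cylinder set of the path $e_1,\dots,e_n$ the measure $\mu(e_1)p_{e_1,e_2}\cdots p_{e_{n-1},e_n}$. For $\omega\in\Omega$ let $w_n=w_n(\omega)\in A^*$ be the label of the initial segment of length $n$ of $\omega$. For each state $q$ choose a shortest directed path from $q$ to an accept state, let $u_q\in A^*$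 be its label, and put $w_n'=w_nu_q$, where $q$ is the state in which the initial segment of length $n$ of $\omega$ ends. Let $\phi:A^*\to G$ be a monoid homomorphism, where $G$ is a group with a left-invariant semi-metric, that is, a function $d_G:G\times G\to[0,\infty)$ such that $d_G(g,k)\le d_G(g,h)+d_G(h,k)$ and $d_G(kg,kh)=d_G(g,h)$ for all $g,h,k\in G$ (neither symmetry nor $d_G(g,g)=0$ is required). Put $|g|_G=d_G(1,g)$. Then there is a number $\lambda=\lambda(M,\phi,d_G)\ge 0$ such that for every initial distribution $\mu$ on $E$ and every choice of the words $u_q$ as above, \[ \lim_{n\to\infty}\frac{|\phi(w_n)|_G}{n}=\lim_{n\to\infty}\frac{|\phi(w_n')|_G}{n}=\lambda \] almost surely and in $L^1$ with respect to $P_\mu$. -/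

import Mathlib

open MeasureTheory ProbabilityTheory Filter Topology
open scoped ENNReal

/-- A nondeterministic automaton over the alphabet `A` with state set `Q`, given by its labelled
directed transition graph, whose set of directed edges is `E` (multiple edges are allowed), a
nonempty set of start states and a set of accept states. It is a finite automaton (NDFA) when `Q`
and `E` are finite. -/
structure NDAutomaton (A Q E : Type*) where
  /-- the origin of an edge -/
  origin : E → Q
  /-- the terminus of an edge -/
  terminus : E → Q
  /-- the label of an edge -/
  label : E → A
  /-- the start states -/
  start : Set Q
  start_nonempty : start.Nonempty
  /-- the accept states -/
  accept : Set Q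

/-- A left-invariant semi-metric on a group `G`: a nonnegative left-invariant function of two
variables satisfying the triangle inequality, so that `fun g => d 1 g` is a nonnegative
subadditive function on `G`. Neither symmetry nor `d g g = 0` is required. -/
structure IsLeftInvariantSemimetric {G : Type*} [Group G] (d : G → G → ℝ) : Prop where
  nonneg : ∀ g h, 0 ≤ d g h
  triangle : ∀ g h k, d g k ≤ d g h + d h k
  left_invariant : ∀ k g h, d (k * g) (k * h) = d g h

namespace NDAutomaton

variable {A Q E : Type*}

/-- `M.IsPath q p r`: the list of edges `p` is a directed edge-path from `q` to `r`. -/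
inductive IsPath (M : NDAutomaton A Q E) : Q → List E → Q → Prop
  | nil (q : Q) : IsPath M q [] q
  | cons (e : E) (p : List E) (r : Q) :
      IsPath M (M.terminus e) p r → IsPath M (M.origin e) (e :: p) r

/-- The automaton is normal: there is an accept state, there is an edge, and the transition graph
is strongly connected. -/
structure IsNormal (M : NDAutomaton A Q E) : Prop where
  accept_nonempty : M.accept.Nonempty
  edge_nonempty : Nonempty E
  strongly_connected : ∀ q r : Q, ∃ p : List E, M.IsPath q p r

/-- The word `u` is the label of a shortest directed path from `q` to an accept state. -/
def IsShortestAcceptLabel (M : NDAutomaton A Q E) (q : Q) (u : FreeMonoid A) : Prop :=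
  ∃ (p : List E) (r : Q), M.IsPath q p r ∧ r ∈ M.accept ∧
    (∀ (p' : List E) (r' : Q), M.IsPath q p' r' → r' ∈ M.accept → p.length ≤ p'.length) ∧
    u = FreeMonoid.ofList (p.map M.label)

theorem IsNormal.exists_origin_eq {M : NDAutomaton A Q E} (hM : M.IsNormal) (q : Q) :
    ∃ e, M.origin e = q := by
  obtain ⟨e⟩ := hM.edge_nonempty
  obtain ⟨p, hp⟩ := hM.strongly_connected q (M.origin e)
  generalize hr : M.origin e = r at hp
  cases hp with
  | nil => exact ⟨e, hr⟩
  | cons f p r h => exact ⟨f, rfl⟩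

open Classical in
/-- The transition probability from the edge `e` to the edge `f`: it is `0` if the origin of `f` is
not the terminus of `e`, and otherwise `1 / m` where `m` is the number of outgoing edges of the
terminus of `e`. -/
noncomputable def transProb (M : NDAutomaton A Q E) (e f : E) : ℝ≥0∞ :=
  if M.origin f = M.terminus e then
    ((Nat.card {g : E // M.origin g = M.terminus e} : ℕ) : ℝ≥0∞)⁻¹
  else 0

theorem sum_transProb [Fintype E] (M : NDAutomaton A Q E) (hM : M.IsNormal) (e : E) :
    ∑ f, M.transProb e f = 1 := by
  classical
  obtain ⟨f, hf⟩ := hM.exists_origin_eq (M.terminus e)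
  have : Nonempty {g : E // M.origin g = M.terminus e} := ⟨⟨f, hf⟩⟩
  have h0 : Nat.card {g : E // M.origin g = M.terminus e} ≠ 0 := Nat.card_pos.ne'
  simp only [transProb]
  rw [← Finset.sum_filter, Finset.sum_const, nsmul_eq_mul, ← Fintype.card_subtype,
    ← Nat.card_eq_fintype_card]
  exact ENNReal.mul_inv_cancel (by exact_mod_cast h0) (ENNReal.natCast_ne_top _)

/-- The transition probabilities out of the edge `e`, as a probability distribution on edges. -/
noncomputable def transition [Fintype E] (M : NDAutomaton A Q E) (hM : M.IsNormal) (e : E) :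
    PMF E :=
  PMF.ofFintype (M.transProb e) (M.sum_transProb hM e)

/-- The transition kernel of the associated Markov chain on the set of edges. -/
noncomputable def edgeKernel [Fintype E] [MeasurableSpace E] [DiscreteMeasurableSpace E]
    (M : NDAutomaton A Q E) (hM : M.IsNormal) : Kernel E E :=
  Kernel.ofFunOfCountable fun e => (M.transition hM e).toMeasure

instance [Fintype E] [MeasurableSpace E] [DiscreteMeasurableSpace E]
    (M : NDAutomaton A Q E) (hM : M.IsNormal) : IsMarkovKernel (M.edgeKernel hM) :=
  ⟨fun e => PMF.toMeasure.isProbabilityMeasure (M.transition hM e)⟩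

/-- The law of the associated Markov chain with initial distribution `μ`, as a measure on the
space of all sequences of edges. -/
noncomputable def chainLaw [Fintype E] [MeasurableSpace E] [DiscreteMeasurableSpace E]
    (M : NDAutomaton A Q E) (hM : M.IsNormal) (μ : PMF E) : Measure (ℕ → E) :=
  Kernel.trajMeasure (X := fun _ => E) μ.toMeasure fun n =>
    (M.edgeKernel hM).comap (fun x : (Finset.Iic n → E) => x ⟨n, Finset.mem_Iic.2 le_rfl⟩)
      (measurable_pi_apply _)

/-- The sample space: the semi-infinite directed edge-paths `ω 0, ω 1, ω 2, …` in the transition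
graph. It carries the σ-algebra generated by the coordinates, that is, by the cylinder sets. -/
abbrev PathSpace (M : NDAutomaton A Q E) : Type _ :=
  {ω : ℕ → E // ∀ n, M.origin (ω (n + 1)) = M.terminus (ω n)}

/-- The measure `P_μ` on the space of semi-infinite edge-paths given by the associated Markov chain
with initial distribution `μ`. -/
noncomputable def pathMeasure [Fintype E] [MeasurableSpace E] [DiscreteMeasurableSpace E]
    (M : NDAutomaton A Q E) (hM : M.IsNormal) (μ : PMF E) : Measure M.PathSpace :=
  (M.chainLaw hM μ).comap Subtype.val

section

variable {A Q E : Type*} [Fintype E] [MeasurableSpace E] [DiscreteMeasurableSpace E]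
    (M : NDAutomaton A Q E) (hM : M.IsNormal) (μ : PMF E)

theorem edgeKernel_singleton (e f : E) : M.edgeKernel hM e {f} = M.transProb e f := by
  change (M.transition hM e).toMeasure {f} = _
  rw [PMF.toMeasure_apply_singleton _ _ (MeasurableSet.singleton f)]; rfl

theorem edgeKernel_compl (e : E) : M.edgeKernel hM e {f | M.origin f ≠ M.terminus e} = 0 := by
  change (M.transition hM e).toMeasure _ = _
  rw [PMF.toMeasure_apply_eq_zero_iff _ .of_discrete, Set.disjoint_left]
  intro f hf hf'
  rw [PMF.mem_support_iff, show M.transition hM e f = M.transProb e f from rfl, transProb] at hf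
  simp_all

instance : IsProbabilityMeasure (M.chainLaw hM μ) := by
  unfold chainLaw
  infer_instance

theorem chainLaw_compProd (n : ℕ) :
    ((M.chainLaw hM μ).map (Preorder.frestrictLe n)) ⊗ₘ
      ((M.edgeKernel hM).comap (fun x : (Finset.Iic n → E) => x ⟨n, Finset.mem_Iic.2 le_rfl⟩)
      (measurable_pi_apply _)) =
    (M.chainLaw hM μ).map (fun x => (Preorder.frestrictLe n x, x (n + 1))) :=
  Kernel.map_frestrictLe_trajMeasure_compProd_eq_map_trajMeasure (X := fun _ => E)

theorem ae_path : ∀ᵐ x ∂M.chainLaw hM μ, ∀ n, M.origin (x (n + 1)) = M.terminus (x n) := by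
  rw [ae_all_iff]
  intro n
  have h := M.chainLaw_compProd hM μ n
  let s : Set ((Finset.Iic n → E) × E) :=
    {y | M.origin y.2 ≠ M.terminus (y.1 ⟨n, Finset.mem_Iic.2 le_rfl⟩)}
  have hs : MeasurableSet s := by
    have : s = (fun y : (Finset.Iic n → E) × E => (y.1 ⟨n, Finset.mem_Iic.2 le_rfl⟩, y.2)) ⁻¹'
      {z : E × E | M.origin z.2 ≠ M.terminus z.1} := rfl
    rw [this]
    exact (by fun_prop : Measurable _) .of_discrete
  have h2 := DFunLike.congr_fun h s
  rw [Measure.compProd_apply hs, Measure.map_apply (by fun_prop) hs] at h2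
  rw [ae_iff]
  refine Eq.trans ?_ (h2.symm.trans ?_)
  · rfl
  · simp only [s]
    refine (lintegral_congr fun x => ?_).trans lintegral_zero
    exact M.edgeKernel_compl hM (x ⟨n, _⟩)

theorem chainLaw_cylinder (γ : ℕ → E) (n : ℕ) :
    M.chainLaw hM μ {x | ∀ i ≤ n, x i = γ i} =
      μ (γ 0) * ∏ i ∈ Finset.range n, M.transProb (γ i) (γ (i + 1)) := by
  have hset : ∀ n, {x : ℕ → E | ∀ i ≤ n, x i = γ i} =
      Preorder.frestrictLe (π := fun _ => E) n ⁻¹' {Preorder.frestrictLe n γ} := by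
    intro n; ext x; simp [funext_iff]
  have hm : ∀ n, Measurable (Preorder.frestrictLe (π := fun _ : ℕ => E) n) := fun n => by fun_prop
  induction n with
  | zero =>
    rw [hset, ← Measure.map_apply (hm 0) .of_discrete, chainLaw, Kernel.trajMeasure,
      Measure.map_comp _ _ (by fun_prop), Kernel.traj_map_frestrictLe, Kernel.partialTraj_self,
      Measure.id_comp, Measure.map_apply (by fun_prop) .of_discrete]
    simp only [Finset.range_zero, Finset.prod_empty, mul_one]
    rw [← PMF.toMeasure_apply_singleton μ (γ 0) .of_discrete]
    congr 1
    ext e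
    rw [Set.mem_preimage, Set.mem_singleton_iff, MeasurableEquiv.symm_apply_eq]
    rfl
  | succ n ih =>
    have h := DFunLike.congr_fun (M.chainLaw_compProd hM μ n)
      ({Preorder.frestrictLe n γ} ×ˢ {γ (n + 1)})
    rw [Measure.compProd_apply_prod .of_discrete .of_discrete,
      Measure.map_apply (by fun_prop) .of_discrete] at h
    rw [Finset.prod_range_succ, ← mul_assoc, ← ih]
    refine Eq.trans ?_ (h.symm.trans ?_)
    · congr 1
      ext x
      simp only [Set.mem_ofPred_eq, Set.mem_preimage, Set.mem_prod, Set.mem_singleton_iff]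
      have := Set.ext_iff.1 (hset n) x
      simp only [Set.mem_ofPred_eq, Set.mem_preimage, Set.mem_singleton_iff] at this
      rw [← this]
      constructor
      · intro h; exact ⟨fun i hi => h i (by omega), h _ le_rfl⟩
      · rintro ⟨h1, h2⟩ i hi
        rcases Nat.lt_or_ge n i with h | h
        · obtain rfl : i = n + 1 := by omega
          exact h2
        · exact h1 i h
    · rw [lintegral_singleton, Measure.map_apply (hm n) .of_discrete, ← hset, mul_comm]
      congr 1
      exact M.edgeKernel_singleton hM (γ n) (γ (n + 1))

theorem measurableSet_path : MeasurableSet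
    {x : ℕ → E | ∀ n, M.origin (x (n + 1)) = M.terminus (x n)} := by
  rw [Set.ofPred_forall]
  refine MeasurableSet.iInter fun n => ?_
  exact (by fun_prop : Measurable fun x : ℕ → E => (x n, x (n + 1)))
    (.of_discrete : MeasurableSet {z : E × E | M.origin z.2 = M.terminus z.1})

/-- Almost every sequence of edges is an edge-path, so the image of `P_μ` is the law of the chain. -/
theorem map_pathMeasure : (M.pathMeasure hM μ).map Subtype.val = M.chainLaw hM μ := by
  rw [pathMeasure]
  refine (map_comap_subtype_coe M.measurableSet_path _).trans ?_
  exact Measure.restrict_eq_self_of_ae_mem (M.ae_path hM μ)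

instance : IsProbabilityMeasure (M.pathMeasure hM μ) := by
  constructor
  have := congrArg (fun m => m Set.univ) (M.map_pathMeasure hM μ)
  simpa [Measure.map_apply measurable_subtype_coe] using this

/-- The formula for the measure `P_μ` of the cylinder set of the initial segment `γ 0, …, γ n`. -/
theorem pathMeasure_cylinder (γ : ℕ → E) (n : ℕ) :
    M.pathMeasure hM μ {ω | ∀ i ≤ n, ω.1 i = γ i} =
      μ (γ 0) * ∏ i ∈ Finset.range n, M.transProb (γ i) (γ (i + 1)) := by
  rw [← M.chainLaw_cylinder hM μ, ← M.map_pathMeasure hM μ,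
    Measure.map_apply measurable_subtype_coe]
  · rfl
  · simp only [Set.ofPred_forall]
    refine .iInter fun i => .iInter fun _ => ?_
    change MeasurableSet ((fun x : ℕ → E => x i) ⁻¹' {γ i})
    exact measurable_pi_apply i (.singleton (γ i))

end

/-- `w_n`: the label of the initial segment of length `n` of `ω`. -/
def word (M : NDAutomaton A Q E) (n : ℕ) (ω : M.PathSpace) : FreeMonoid A :=
  FreeMonoid.ofList (List.ofFn fun i : Fin n => M.label (ω.1 i))

/-- The state in which the initial segment of length `n` of `ω` ends. -/
def endState (M : NDAutomaton A Q E) (n : ℕ) (ω : M.PathSpace) : Q :=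
  match n with
  | 0 => M.origin (ω.1 0)
  | k + 1 => M.terminus (ω.1 k)

/-- `w_n' = w_n u_q`, where `q` is the state in which the initial segment of length `n` ends. -/
def extendedWord (M : NDAutomaton A Q E) (u : Q → FreeMonoid A) (n : ℕ) (ω : M.PathSpace) :
    FreeMonoid A :=
  M.word n ω * u (M.endState n ω)

end NDAutomaton

/-! The lengths `a n x = d 1 (φ (M.seqWord n x))` form a subadditive cocycle over the shift, so this
is a Kingman-type theorem. The chain need not be stationary, so the argument works with the laws
`edgeLaw e` started at single edges, with bounds uniform in the finitely many `e`. The limit is the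
infimum over `n ≥ 1` of `max_e E_e[a n] / n` (`growthRate`).

Upper bound (`ae_eventually_le`): for `c` above the rate, some block length `k` has mean slope below
`c` from every edge. By the Markov property the exponential moments of successive blocks multiply,
and Chernoff with Borel–Cantelli concludes.

Lower bound (`ae_eventually_ge`): the event that the lower growth rate is below `c` is
shift-invariant, hence null from every edge or full from every edge (`edgeLaw_zero_or_one`). If it
were full, cutting the path into blocks of slope at most `c` (`le_of_blocks`) would force
`growthRate ≤ c` (`growthRate_le_of_ae`).

Any initial law is a mixture of edge laws, `L¹` convergence follows by domination, and appending `u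
q` changes lengths by a bounded amount. -/

/-! ### Shifts and cylinder sets of sequences. -/

/-- The sequence `x k, x (k + 1), …`. -/
def seqShift {E : Type*} (k : ℕ) (x : ℕ → E) : ℕ → E := fun i => x (i + k)

/-- The sequence `e, x 0, x 1, …`. -/
def seqCons {E : Type*} (e : E) (x : ℕ → E) : ℕ → E
  | 0 => e
  | n + 1 => x n

@[simp] theorem seqCons_zero {E : Type*} (e : E) (x : ℕ → E) : seqCons e x 0 = e := rfl

@[simp] theorem seqShift_zero {E : Type*} (x : ℕ → E) : seqShift 0 x = x := rfl

theorem seqShift_add {E : Type*} (k l : ℕ) (x : ℕ → E) :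
    seqShift k (seqShift l x) = seqShift (k + l) x := by
  funext i
  simp [seqShift, add_assoc]

theorem measurable_seqShift {E : Type*} [MeasurableSpace E] (k : ℕ) :
    Measurable (seqShift k : (ℕ → E) → ℕ → E) :=
  measurable_pi_lambda _ fun i => measurable_pi_apply (i + k)

theorem measurable_seqCons {E : Type*} [MeasurableSpace E] (e : E) : Measurable (seqCons e) := by
  refine measurable_pi_lambda _ fun i => ?_
  cases i with
  | zero => exact measurable_const
  | succ n => exact measurable_pi_apply n

/-- A function of finitely many coordinates in a finite set is measurable. -/
theorem measurable_of_dependsOn {E β : Type*} [Finite E] [MeasurableSpace E]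
    [DiscreteMeasurableSpace E] [MeasurableSpace β] {g : (ℕ → E) → β} {n : ℕ}
    (hg : DependsOn g (Set.Iio n)) : Measurable g := by
  classical
  rcases isEmpty_or_nonempty E with h | h
  · exact measurable_of_empty g
  · let ext : (Fin n → E) → ℕ → E :=
      fun z i => if h : i < n then z ⟨i, h⟩ else Classical.arbitrary E
    have : g = (fun z => g (ext z)) ∘ fun (x : ℕ → E) (i : Fin n) => x i := by
      funext x
      refine hg fun i hi => ?_
      simp only [Set.mem_Iio] at hi
      simp [ext, hi]
    rw [this]
    exact Measurable.of_discrete.comp (by fun_prop)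

theorem setOf_forall_le_eq_preimage {E : Type*} (γ : ℕ → E) (n : ℕ) :
    {x : ℕ → E | ∀ i ≤ n, x i = γ i} =
      Preorder.frestrictLe (π := fun _ => E) n ⁻¹' {Preorder.frestrictLe n γ} := by
  ext x
  simp [funext_iff]

theorem measurableSet_cylinder_seq {E : Type*} [Finite E] [MeasurableSpace E]
    [DiscreteMeasurableSpace E] (γ : ℕ → E) (n : ℕ) :
    MeasurableSet {x : ℕ → E | ∀ i ≤ n, x i = γ i} := by
  rw [setOf_forall_le_eq_preimage]
  exact (by fun_prop : Measurable (Preorder.frestrictLe (π := fun _ : ℕ => E) n)) .of_discrete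

/-- Finite measures on sequences are determined by the cylinder sets. -/
theorem measure_ext_of_cylinder {E : Type*} [Finite E] [MeasurableSpace E]
    [DiscreteMeasurableSpace E] {μ ν : Measure (ℕ → E)} [IsFiniteMeasure ν]
    (h : ∀ (γ : ℕ → E) (n : ℕ), μ {x | ∀ i ≤ n, x i = γ i} = ν {x | ∀ i ≤ n, x i = γ i}) :
    μ = ν := by
  classical
  rcases isEmpty_or_nonempty E with hE | ⟨⟨e⟩⟩
  · exact Measure.ext_of_singleton fun a => hE.elim (a 0)
  have hm : ∀ n, Measurable (Preorder.frestrictLe (π := fun _ : ℕ => E) n) := fun n => by fun_prop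
  have key : ∀ n, μ.map (Preorder.frestrictLe n) = ν.map (Preorder.frestrictLe n) := by
    intro n
    refine Measure.ext_of_singleton fun z => ?_
    obtain ⟨γ, rfl⟩ : ∃ γ : ℕ → E, Preorder.frestrictLe (π := fun _ => E) n γ = z :=
      ⟨fun i => if hi : i ∈ Finset.Iic n then z ⟨i, hi⟩ else e, by
        funext i
        simp [Finset.mem_Iic.1 i.2]⟩
    rw [Measure.map_apply (hm n) .of_discrete, Measure.map_apply (hm n) .of_discrete,
      ← setOf_forall_le_eq_preimage, h]
  refine IsProjectiveLimit.unique (P := fun I => ν.map I.restrict) (fun I => ?_) (fun I => rfl)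
  -- Every finite set of coordinates lies in an initial segment, where the marginals already agree.
  have hI : I ⊆ Finset.Iic (I.sup id) := fun i hi => Finset.mem_Iic.2 (Finset.le_sup (f := id) hi)
  have hc : I.restrict (π := fun _ => E) =
      Finset.restrict₂ (π := fun _ => E) hI ∘ Preorder.frestrictLe (I.sup id) := rfl
  rw [hc, ← Measure.map_map (by fun_prop) (hm _), key, Measure.map_map (by fun_prop) (hm _), ← hc]

/-! ### The Markov property. -/

namespace NDAutomaton

variable {A Q E : Type*} [Fintype E] [MeasurableSpace E] [DiscreteMeasurableSpace E]
    (M : NDAutomaton A Q E) (hM : M.IsNormal)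

/-- The law of the associated Markov chain started at the edge `e`. -/
noncomputable def edgeLaw (e : E) : Measure (ℕ → E) := M.chainLaw hM (PMF.pure e)

instance (e : E) : IsProbabilityMeasure (M.edgeLaw hM e) := by
  unfold edgeLaw
  infer_instance

theorem edgeLaw_cylinder (e : E) (γ : ℕ → E) (n : ℕ) :
    M.edgeLaw hM e {x | ∀ i ≤ n, x i = γ i} =
      PMF.pure e (γ 0) * ∏ i ∈ Finset.range n, M.transProb (γ i) (γ (i + 1)) :=
  M.chainLaw_cylinder hM _ γ n

/-- Cylinder probabilities are linear in the initial distribution. This reduces almost sure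
statements to chains started at one edge. -/
theorem chainLaw_eq_sum (μ : PMF E) : M.chainLaw hM μ = ∑ e, μ e • M.edgeLaw hM e := by
  classical
  refine (measure_ext_of_cylinder fun γ n => ?_).symm
  rw [M.chainLaw_cylinder]
  simp [M.edgeLaw_cylinder, PMF.pure_apply]

/-- The Markov property after one step. -/
theorem edgeLaw_eq_sum (e : E) :
    M.edgeLaw hM e = ∑ f, M.transProb e f • (M.edgeLaw hM f).map (seqCons e) := by
  classical
  refine (measure_ext_of_cylinder fun γ n => ?_).symm
  rw [M.edgeLaw_cylinder]
  simp only [Measure.coe_finsetSum, Finset.sum_apply, Measure.smul_apply, smul_eq_mul,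
    Measure.map_apply (measurable_seqCons e) (measurableSet_cylinder_seq γ n)]
  by_cases h0 : γ 0 = e
  · cases n with
    | zero =>
      have : ∀ f, M.edgeLaw hM f (seqCons e ⁻¹' {x | ∀ i ≤ 0, x i = γ i}) = 1 := by
        intro f
        have : seqCons e ⁻¹' {x | ∀ i ≤ 0, x i = γ i} = Set.univ := by
          ext x
          simp [h0]
        rw [this, measure_univ]
      simp [M.sum_transProb hM, h0]
    | succ n =>
      have : seqCons e ⁻¹' {x | ∀ i ≤ n + 1, x i = γ i} =
          {x | ∀ i ≤ n, x i = seqShift 1 γ i} := by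
        ext x
        constructor
        · intro h i hi
          exact h (i + 1) (by omega)
        · intro h i hi
          cases i with
          | zero => exact h0.symm
          | succ i => exact h i (by omega)
      simp only [this, M.edgeLaw_cylinder, PMF.pure_apply]
      simp [seqShift, Finset.prod_range_succ', h0, mul_comm]
  · have : seqCons e ⁻¹' {x | ∀ i ≤ n, x i = γ i} = ∅ := by
      ext x
      simp only [Set.mem_preimage, Set.mem_ofPred_eq, Set.mem_empty_iff_false, iff_false]
      exact fun h => h0 (h 0 (Nat.zero_le n)).symm
    simp [this, h0]

theorem lintegral_edgeLaw (e : E) {g : (ℕ → E) → ℝ≥0∞} (hg : Measurable g) :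
    ∫⁻ x, g x ∂M.edgeLaw hM e =
      ∑ f, M.transProb e f * ∫⁻ y, g (seqCons e y) ∂M.edgeLaw hM f := by
  conv_lhs => rw [M.edgeLaw_eq_sum hM e]
  rw [lintegral_finsetSum_measure]
  refine Finset.sum_congr rfl fun f _ => ?_
  rw [lintegral_smul_measure, lintegral_map hg (measurable_seqCons e), smul_eq_mul]

/-- The Markov property at time `k`. -/
theorem lintegral_mul_comp_seqShift (k : ℕ) {G H : (ℕ → E) → ℝ≥0∞}
    (hG : DependsOn G (Set.Iio k)) (hH : Measurable H) (e : E) :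
    ∫⁻ x, G x * H (seqShift k x) ∂M.edgeLaw hM e =
      ∫⁻ x, G x * ∫⁻ y, H y ∂M.edgeLaw hM (x k) ∂M.edgeLaw hM e := by
  have hmeas : ∀ k, Measurable fun x : ℕ → E => ∫⁻ y, H y ∂M.edgeLaw hM (x k) := fun k =>
    (Measurable.of_discrete (f := fun f : E => ∫⁻ y, H y ∂M.edgeLaw hM f)).comp
      (measurable_pi_apply k)
  -- Peeling off the first edge changes both the starting edge and `G`, so both are generalized.
  induction k generalizing G e with
  | zero =>
    have hc : ∀ x, G x = G fun _ => e := fun x => hG fun i hi => by simp at hi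
    have h0 : ∫⁻ x, ∫⁻ y, H y ∂M.edgeLaw hM (x 0) ∂M.edgeLaw hM e =
        ∫⁻ y, H y ∂M.edgeLaw hM e := by
      rw [M.lintegral_edgeLaw hM e (hmeas 0)]
      simp [← Finset.sum_mul, M.sum_transProb hM]
    simp only [hc, seqShift_zero]
    rw [lintegral_const_mul _ hH, lintegral_const_mul _ (hmeas 0), h0]
  | succ k ih =>
    have hGm := measurable_of_dependsOn hG
    have h1 : Measurable fun x => G x * H (seqShift (k + 1) x) :=
      hGm.mul (hH.comp (measurable_seqShift _))
    have h2 : Measurable fun x => G x * ∫⁻ y, H y ∂M.edgeLaw hM (x (k + 1)) := hGm.mul (hmeas _)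
    rw [M.lintegral_edgeLaw hM e h1, M.lintegral_edgeLaw hM e h2]
    refine Finset.sum_congr rfl fun f _ => ?_
    congr 1
    refine ih (G := fun y => G (seqCons e y)) (fun x y h => hG fun i hi => ?_) f
    cases i with
    | zero => rfl
    | succ i => exact h i (Nat.lt_of_succ_lt_succ hi)

/-- A bound uniform in the starting edge takes the place of independence of past and future. -/
theorem lintegral_mul_comp_seqShift_le (k : ℕ) {G H : (ℕ → E) → ℝ≥0∞} {c : ℝ≥0∞}
    (hG : DependsOn G (Set.Iio k)) (hH : Measurable H) (hc : ∀ f, ∫⁻ y, H y ∂M.edgeLaw hM f ≤ c)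
    (e : E) :
    ∫⁻ x, G x * H (seqShift k x) ∂M.edgeLaw hM e ≤ (∫⁻ x, G x ∂M.edgeLaw hM e) * c := by
  rw [M.lintegral_mul_comp_seqShift hM k hG hH, ← lintegral_mul_const _ (measurable_of_dependsOn hG)]
  exact lintegral_mono fun x => mul_le_mul_right (hc _) _

/-! ### Harmonic functions and the zero-one law. -/

omit [MeasurableSpace E] [DiscreteMeasurableSpace E] in
/-- A harmonic function on the edges is constant, by strong connectedness. -/
theorem IsNormal.harmonic_const {M : NDAutomaton A Q E} (hM : M.IsNormal) {h : E → ℝ≥0∞} (hfin : ∀ e, h e ≠ ∞)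
    (hh : ∀ e, h e = ∑ f, M.transProb e f * h f) (e f : E) : h e = h f := by
  classical
  obtain ⟨m, hm⟩ : ∃ m, ∀ e, h e ≤ h m := by
    have := hM.edge_nonempty
    exact Finite.exists_max h
  -- Maximum principle: an average equal to the maximum forces every term of positive weight to be
  -- maximal.
  have step : ∀ e f, h e = h m → M.origin f = M.terminus e → h f = h m := by
    intro e f he hef
    by_contra hne
    have hlt : h f < h m := lt_of_le_of_ne (hm f) hne
    have hp : M.transProb e f ≠ 0 := by
      simp only [transProb, hef, if_true]
      exact ENNReal.inv_ne_zero.2 (ENNReal.natCast_ne_top _)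
    have hpt : ∀ g, M.transProb e g ≠ ∞ := fun g => by
      have : M.transProb e g ≤ 1 := by
        rw [← M.sum_transProb hM e]
        exact Finset.single_le_sum (fun _ _ => zero_le) (Finset.mem_univ g)
      exact ne_top_of_le_ne_top ENNReal.one_ne_top this
    have hsum : ∑ g, M.transProb e g * h m = ∑ g, M.transProb e g * h g := by
      rw [← hh, ← Finset.sum_mul, M.sum_transProb hM, one_mul, he]
    rw [← Finset.add_sum_erase _ _ (Finset.mem_univ f),
      ← Finset.add_sum_erase _ _ (Finset.mem_univ f)] at hsum
    have hle : ∑ g ∈ Finset.univ.erase f, M.transProb e g * h g ≤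
        ∑ g ∈ Finset.univ.erase f, M.transProb e g * h m :=
      Finset.sum_le_sum fun g _ => mul_le_mul_right (hm g) _
    have htop : ∑ g ∈ Finset.univ.erase f, M.transProb e g * h g ≠ ∞ :=
      ENNReal.sum_ne_top.2 fun g _ => ENNReal.mul_ne_top (hpt g) (hfin g)
    have hcancel := (add_le_add_right hle (M.transProb e f * h m)).trans hsum.le
    exact hlt.not_ge ((ENNReal.mul_le_mul_iff_right hp (hpt f)).1
      ((ENNReal.add_le_add_iff_right htop).1 hcancel))
  have path : ∀ (q r : Q) (p : List E), M.IsPath q p r →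
      ∀ e, M.terminus e = q → h e = h m → ∀ f, M.origin f = r → h f = h m := by
    intro q r p hp
    induction hp with
    | nil q => exact fun e he hem f hf => step e f hem (hf.trans he.symm)
    | cons g p r _ ih => exact fun e he hem f hf => ih g rfl (step e g hem he.symm) f hf
  have all : ∀ f, h f = h m := fun f => by
    obtain ⟨p, hp⟩ := hM.strongly_connected (M.terminus m) (M.origin f)
    exact path _ _ p hp m rfl rfl f rfl
  rw [all e, all f]

/-- The zero-one law for shift-invariant events. -/
theorem edgeLaw_zero_or_one {S : Set (ℕ → E)} (hS : MeasurableSet S)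
    (hinv : ∀ x, seqShift 1 x ∈ S ↔ x ∈ S) :
    (∀ e, M.edgeLaw hM e S = 0) ∨ ∀ e, M.edgeLaw hM e S = 1 := by
  classical
  have hinvk : ∀ k x, seqShift k x ∈ S ↔ x ∈ S := by
    intro k
    induction k with
    | zero => exact fun x => Iff.rfl
    | succ k ih => exact fun x => by rw [add_comm, ← seqShift_add, hinv, ih]
  have hind : Measurable (S.indicator (1 : (ℕ → E) → ℝ≥0∞)) := measurable_one.indicator hS
  -- Invariance lets the first edge be dropped, so the probability of `S` is harmonic in the
  -- starting edge.
  have hconst : ∀ e f, M.edgeLaw hM e S = M.edgeLaw hM f S := by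
    refine hM.harmonic_const (fun e => measure_ne_top _ _) fun e => ?_
    rw [← lintegral_indicator_one hS, M.lintegral_edgeLaw hM e hind]
    refine Finset.sum_congr rfl fun f _ => ?_
    rw [← lintegral_indicator_one hS]
    congr 1
    refine lintegral_congr fun y => ?_
    have : seqCons e y ∈ S ↔ y ∈ S := (hinv (seqCons e y)).symm
    simp [Set.indicator_apply, this]
  have hsq : ∀ e, M.edgeLaw hM e S = M.edgeLaw hM e S * M.edgeLaw hM e S := by
    intro e
    -- By the Markov property and `hconst`, `S` is independent of every cylinder, hence of itself.
    have hr : (M.edgeLaw hM e).restrict S = M.edgeLaw hM e S • M.edgeLaw hM e := by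
      refine (measure_ext_of_cylinder fun γ n => ?_).symm
      set C : Set (ℕ → E) := {x | ∀ i ≤ n, x i = γ i} with hC
      have hCm : MeasurableSet C := measurableSet_cylinder_seq γ n
      have hdep : DependsOn (C.indicator (1 : (ℕ → E) → ℝ≥0∞)) (Set.Iio (n + 1)) := by
        intro x y hxy
        have : x ∈ C ↔ y ∈ C := by
          simp only [hC, Set.mem_ofPred_eq]
          exact forall₂_congr fun i hi => by rw [hxy i (Nat.lt_succ_of_le hi)]
        simp [Set.indicator_apply, this]
      have := M.lintegral_mul_comp_seqShift hM (n + 1) hdep hind e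
      simp only [lintegral_indicator_one hS, fun x : ℕ → E => hconst (x (n + 1)) e] at this
      rw [lintegral_mul_const _ (measurable_one.indicator hCm), lintegral_indicator_one hCm] at this
      rw [Measure.restrict_apply hCm, Measure.smul_apply, smul_eq_mul, mul_comm, ← this,
        ← lintegral_indicator_one (hCm.inter hS)]
      refine lintegral_congr fun x => ?_
      simp only [Set.indicator_apply, hinvk, Set.mem_inter_iff, Pi.one_apply]
      by_cases h1 : x ∈ C <;> by_cases h2 : x ∈ S <;> simp [h1, h2]
    have := congrArg (fun m => m S) hr
    simpa using this
  obtain ⟨e⟩ := hM.edge_nonempty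
  by_cases h0 : M.edgeLaw hM e S = 0
  · exact .inl fun f => (hconst f e).trans h0
  · refine .inr fun f => (hconst f e).trans ?_
    have := hsq e
    nth_rewrite 1 [← mul_one (M.edgeLaw hM e S)] at this
    exact ((ENNReal.mul_right_inj h0 (measure_ne_top _ _)).1 this).symm

end NDAutomaton

/-! ### Subadditive cocycles. -/

/-- A nonnegative subadditive cocycle over the shift on sequences, whose `n`-th term depends on the
first `n` coordinates, with growth and variation controlled by `C`. -/
structure IsSubadditiveCocycle {E : Type*} (a : ℕ → (ℕ → E) → ℝ) (C : ℝ) : Prop where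
  pos : 0 < C
  nonneg : ∀ n x, 0 ≤ a n x
  subadd : ∀ m n x, a (m + n) x ≤ a m x + a n (seqShift m x)
  dependsOn : ∀ n, DependsOn (a n) (Set.Iio n)
  le : ∀ n x, a n x ≤ C * (n + 1)
  shift_le : ∀ n x, a n (seqShift 1 x) ≤ a (n + 1) x + C

namespace IsSubadditiveCocycle

variable {E : Type*} {a : ℕ → (ℕ → E) → ℝ} {C : ℝ} (ha : IsSubadditiveCocycle a C)
include ha

theorem measurable [Finite E] [MeasurableSpace E] [DiscreteMeasurableSpace E] (n : ℕ) :
    Measurable (a n) :=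
  measurable_of_dependsOn (ha.dependsOn n)

theorem integrable [Finite E] [MeasurableSpace E] [DiscreteMeasurableSpace E]
    (μ : Measure (ℕ → E)) [IsFiniteMeasure μ] (n : ℕ) : Integrable (a n) μ :=
  .of_bound (ha.measurable n).aestronglyMeasurable (C * (n + 1)) <| ae_of_all _ fun x => by
    rw [Real.norm_of_nonneg (ha.nonneg n x)]
    exact ha.le n x

/-- The decomposition of a sequence into blocks of length at most `L` on which the cocycle grows
with slope at most `c`, and the exceptional positions where no such block starts. -/
theorem le_of_blocks {c : ℝ} (hc : 0 ≤ c) (L n : ℕ) (x : ℕ → E) :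
    a n x ≤ c * n + 2 * C * ∑ i ∈ Finset.range n,
      {y | ∀ m : ℕ, 1 ≤ m → m ≤ L → c * m < a m y}.indicator (1 : (ℕ → E) → ℝ) (seqShift i x) +
        C * (L + 1) := by
  set B : Set (ℕ → E) := {y | ∀ m : ℕ, 1 ≤ m → m ≤ L → c * m < a m y} with hB
  have hC := ha.pos
  have hχ : ∀ y, 0 ≤ B.indicator (1 : (ℕ → E) → ℝ) y :=
    fun y => Set.indicator_nonneg (fun _ _ => zero_le_one) y
  induction n using Nat.strong_induction_on generalizing x with
  | _ n ih =>
    rcases le_or_gt n L with hn | hn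
    · have h1 : a n x ≤ C * (L + 1) :=
        (ha.le n x).trans (mul_le_mul_of_nonneg_left (by exact_mod_cast Nat.succ_le_succ hn) hC.le)
      have h2 : 0 ≤ 2 * C * ∑ i ∈ Finset.range n,
          B.indicator (1 : (ℕ → E) → ℝ) (seqShift i x) :=
        mul_nonneg (by positivity) (Finset.sum_nonneg fun i _ => hχ _)
      have h3 : 0 ≤ c * n := by positivity
      linarith
    -- A bad position is passed by one edge at cost `a 1 x ≤ 2 * C`; from any other position a block
    -- of length `m ≤ L` costs at most `c * m`.
    · by_cases hx : x ∈ B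
      · obtain ⟨k, rfl⟩ : ∃ k, n = k + 1 := ⟨n - 1, by omega⟩
        have h1 := ha.subadd 1 k x
        have h2 := ha.le 1 x
        have h3 := ih k (by omega) (seqShift 1 x)
        simp only [seqShift_add] at h3
        rw [Finset.sum_range_succ', seqShift_zero, Set.indicator_of_mem hx, Pi.one_apply]
        rw [add_comm 1 k] at h1
        push_cast at h2 ⊢
        linarith
      · simp only [hB, Set.mem_ofPred_eq, not_forall, not_lt] at hx
        obtain ⟨m, hm1, hmL, hm⟩ := hx
        obtain ⟨k, rfl⟩ : ∃ k, n = m + k := ⟨n - m, by omega⟩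
        have h1 := ha.subadd m k x
        have h3 := ih k (by omega) (seqShift m x)
        simp only [seqShift_add] at h3
        have h4 : ∑ i ∈ Finset.range k, B.indicator (1 : (ℕ → E) → ℝ) (seqShift (i + m) x) ≤
            ∑ i ∈ Finset.range (m + k), B.indicator (1 : (ℕ → E) → ℝ) (seqShift i x) := by
          rw [Finset.sum_range_add]
          simp only [add_comm m]
          exact le_add_of_nonneg_left (Finset.sum_nonneg fun i _ => hχ _)
        have h5 := mul_le_mul_of_nonneg_left h4 (by positivity : 0 ≤ 2 * C)
        push_cast
        linarith

/-- The event that the lower growth rate of a cocycle is less than `c` is shift-invariant. -/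
theorem seqShift_mem_iff (c : ℝ) (x : ℕ → E) :
    (∃ q : ℚ, (q : ℝ) < c ∧ ∃ᶠ n : ℕ in atTop, a n (seqShift 1 x) < q * n) ↔
      ∃ q : ℚ, (q : ℝ) < c ∧ ∃ᶠ n : ℕ in atTop, a n x < q * n := by
  -- Raising the slope from `q` to a rational `r < c` absorbs the additive error made by deleting or
  -- restoring one edge.
  have hev : ∀ (q r : ℚ), q < r → ∀ K : ℝ, ∀ᶠ n : ℕ in atTop, (q : ℝ) * n + K < r * n := by
    intro q r hqr K
    have hqr' : (0 : ℝ) < r - q := by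
      have : (q : ℝ) < r := by exact_mod_cast hqr
      linarith
    filter_upwards [eventually_gt_atTop ⌈K / (r - q)⌉₊] with n hn
    have := (div_lt_iff₀ hqr').1 (Nat.lt_of_ceil_lt hn)
    linarith
  have hsucc : ∀ p : ℕ → Prop, (∃ᶠ n in atTop, p n) ↔ ∃ᶠ n in atTop, p (n + 1) := by
    intro p
    conv_lhs => rw [← map_add_atTop_eq_nat 1]
    exact frequently_map
  constructor
  · rintro ⟨q, hq, h⟩
    obtain ⟨r, hqr, hr⟩ := exists_rat_btwn hq
    refine ⟨r, hr, (hsucc _).2 ?_⟩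
    refine (h.and_eventually (hev q r (by exact_mod_cast hqr) (2 * C - r))).mono ?_
    rintro n ⟨h1, h2⟩
    have h3 := ha.subadd 1 n x
    have h4 := ha.le 1 x
    rw [add_comm 1 n] at h3
    push_cast at h4 ⊢
    linarith
  -- Subadditivity gives no upper bound for the shifted value here; `shift_le` does.
  · rintro ⟨q, hq, h⟩
    obtain ⟨r, hqr, hr⟩ := exists_rat_btwn hq
    refine ⟨r, hr, ?_⟩
    refine (((hsucc _).1 h).and_eventually (hev q r (by exact_mod_cast hqr) (C + q))).mono ?_
    rintro n ⟨h1, h2⟩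
    have h3 := ha.shift_le n x
    push_cast at h1
    linarith

end IsSubadditiveCocycle

/-! ### The growth rate and the subadditive ergodic theorem. -/

namespace NDAutomaton

variable {A Q E : Type*} [Fintype E] [MeasurableSpace E] [DiscreteMeasurableSpace E]
    (M : NDAutomaton A Q E) (hM : M.IsNormal)

/-- The infimum over `n ≥ 1` of the largest expectation of `a n / n` for a chain started at an
edge. -/
noncomputable def growthRate (a : ℕ → (ℕ → E) → ℝ) : ℝ :=
  ⨅ n : ℕ, (⨆ e, ∫ x, a (n + 1) x ∂M.edgeLaw hM e) / (n + 1 : ℕ)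

/-- The supremum over edges sits inside the infimum, so one block length serves all starting edges.
-/
theorem exists_integral_lt {a : ℕ → (ℕ → E) → ℝ} {c : ℝ} (hc : M.growthRate hM a < c) :
    ∃ k : ℕ, 1 ≤ k ∧ ∀ e, ∫ x, a k x ∂M.edgeLaw hM e < c * k := by
  obtain ⟨n, hn⟩ := exists_lt_of_ciInf_lt hc
  refine ⟨n + 1, by omega, fun e => ?_⟩
  rw [div_lt_iff₀ (by positivity)] at hn
  exact (le_ciSup (f := fun e => ∫ x, a (n + 1) x ∂M.edgeLaw hM e)
    (Set.finite_range _).bddAbove e).trans_lt hn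

variable {a : ℕ → (ℕ → E) → ℝ} {C : ℝ} (ha : IsSubadditiveCocycle a C)
include ha

theorem growthRate_term_nonneg (n : ℕ) :
    0 ≤ (⨆ e, ∫ x, a (n + 1) x ∂M.edgeLaw hM e) / (n + 1 : ℕ) :=
  div_nonneg (Real.iSup_nonneg fun _ => integral_nonneg fun _ => ha.nonneg _ _) (Nat.cast_nonneg _)

theorem growthRate_nonneg : 0 ≤ M.growthRate hM a :=
  Real.iInf_nonneg (M.growthRate_term_nonneg hM ha)

theorem growthRate_mul_le {n : ℕ} (hn : 1 ≤ n) {b : ℝ}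
    (hb : ∀ e, ∫ x, a n x ∂M.edgeLaw hM e ≤ b) : M.growthRate hM a * n ≤ b := by
  have := hM.edge_nonempty
  obtain ⟨k, rfl⟩ : ∃ k, n = k + 1 := ⟨n - 1, by omega⟩
  rw [← le_div_iff₀ (by positivity)]
  refine (ciInf_le ⟨0, ?_⟩ k).trans
    (div_le_div_of_nonneg_right (ciSup_le hb) (Nat.cast_nonneg _))
  rintro _ ⟨n, rfl⟩
  exact M.growthRate_term_nonneg hM ha n

/-- An exponential moment bound along multiples of a block length. -/
theorem lintegral_exp_le {k : ℕ} {θ ρ : ℝ} (hθ : 0 ≤ θ)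
    (hρ : ∀ e, ∫⁻ x, ENNReal.ofReal (Real.exp (θ * a k x)) ∂M.edgeLaw hM e ≤ ENNReal.ofReal ρ)
    (m : ℕ) (e : E) :
    ∫⁻ x, ENNReal.ofReal (Real.exp (θ * a (m * k) x)) ∂M.edgeLaw hM e ≤
      ENNReal.ofReal (Real.exp (θ * C)) * ENNReal.ofReal ρ ^ m := by
  induction m generalizing e with
  | zero =>
    -- `a 0` need not vanish, only `a 0 ≤ C`; this is the factor `exp (θ * C)`.
    calc ∫⁻ x, ENNReal.ofReal (Real.exp (θ * a (0 * k) x)) ∂M.edgeLaw hM e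
        ≤ ∫⁻ _, ENNReal.ofReal (Real.exp (θ * C)) ∂M.edgeLaw hM e := by
          refine lintegral_mono fun x => ENNReal.ofReal_le_ofReal (Real.exp_le_exp.2 ?_)
          have := ha.le 0 x
          rw [zero_mul]
          exact mul_le_mul_of_nonneg_left (by simpa using this) hθ
      _ = _ := by simp
  | succ m ih =>
    have hdep : DependsOn (fun x => ENNReal.ofReal (Real.exp (θ * a k x))) (Set.Iio k) :=
      fun x y h => by simp only [ha.dependsOn k h]
    have hmeas : Measurable fun x => ENNReal.ofReal (Real.exp (θ * a (m * k) x)) := by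
      have := ha.measurable (m * k)
      fun_prop
    calc ∫⁻ x, ENNReal.ofReal (Real.exp (θ * a ((m + 1) * k) x)) ∂M.edgeLaw hM e
        ≤ ∫⁻ x, ENNReal.ofReal (Real.exp (θ * a k x)) *
            ENNReal.ofReal (Real.exp (θ * a (m * k) (seqShift k x))) ∂M.edgeLaw hM e := by
          refine lintegral_mono fun x => ?_
          rw [← ENNReal.ofReal_mul (Real.exp_pos _).le, ← Real.exp_add, ← mul_add,
            add_mul, one_mul, add_comm (m * k)]
          exact ENNReal.ofReal_le_ofReal
            (Real.exp_le_exp.2 (mul_le_mul_of_nonneg_left (ha.subadd _ _ _) hθ))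
      _ ≤ ENNReal.ofReal ρ * (ENNReal.ofReal (Real.exp (θ * C)) * ENNReal.ofReal ρ ^ m) :=
          (M.lintegral_mul_comp_seqShift_le hM k hdep hmeas ih e).trans (by gcongr; exact hρ e)
      _ = _ := by ring

/-- Upper bound: almost surely the cocycle eventually grows with slope at most any number above the
growth rate. -/
theorem ae_eventually_le {c : ℝ} (hc : M.growthRate hM a < c) (e : E) :
    ∀ᵐ x ∂M.edgeLaw hM e, ∀ᶠ n : ℕ in atTop, a n x ≤ c * n := by
  -- Three slopes: `c₀` bounds the mean over a block, `c₁` is the Chernoff threshold at multiples of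
  -- `k`, and `c` absorbs the incomplete last block.
  obtain ⟨c₁, hc₁, hc₁c⟩ := exists_between hc
  obtain ⟨c₀, hc₀, hc₀₁⟩ := exists_between hc₁
  have h0 : 0 ≤ c₁ := ((M.growthRate_nonneg hM ha).trans_lt hc₁).le
  have hC := ha.pos
  obtain ⟨k, hk, hlt⟩ := M.exists_integral_lt hM hc₀
  have hk0 : (0 : ℝ) < k := by exact_mod_cast hk
  obtain ⟨D, hD⟩ : ∃ D, D = C * ((k : ℝ) + 1) := ⟨_, rfl⟩
  have hD0 : 0 < D := by rw [hD]; positivity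
  have hd : 0 < (c₁ - c₀) * k := mul_pos (sub_pos.2 hc₀₁) hk0
  -- With `a k ≤ D`, the first bound on `θ` validates `exp t ≤ 1 + t + t ^ 2`; the second makes the
  -- linear gain beat the quadratic error, so that `r < 1` below.
  obtain ⟨θ, hθ0, hθ1, hθ2⟩ : ∃ θ : ℝ, 0 < θ ∧ θ * D ≤ 1 ∧ θ * D ^ 2 < (c₁ - c₀) * k := by
    refine ⟨min (1 / D) ((c₁ - c₀) * k / (2 * D ^ 2)), by positivity, ?_, ?_⟩
    · exact (le_div_iff₀ hD0).1 (min_le_left _ _)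
    · have := (le_div_iff₀ (by positivity)).1
        (min_le_right (1 / D) ((c₁ - c₀) * k / (2 * D ^ 2)))
      linarith
  have hρ : ∀ e, ∫⁻ x, ENNReal.ofReal (Real.exp (θ * a k x)) ∂M.edgeLaw hM e ≤
      ENNReal.ofReal (Real.exp (θ * (c₀ * k) + (θ * D) ^ 2)) := by
    intro e
    have hint := (ha.integrable (M.edgeLaw hM e) k).const_mul θ
    have hpt : ∀ x, Real.exp (θ * a k x) ≤ θ * a k x + (1 + (θ * D) ^ 2) := by
      intro x
      have h1 : 0 ≤ θ * a k x := mul_nonneg hθ0.le (ha.nonneg k x)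
      have h2 : θ * a k x ≤ θ * D :=
        mul_le_mul_of_nonneg_left ((ha.le k x).trans_eq hD.symm) hθ0.le
      have h3 := Real.abs_exp_sub_one_sub_id_le (x := θ * a k x)
        (by rw [abs_of_nonneg h1]; exact h2.trans hθ1)
      have h4 : (θ * a k x) ^ 2 ≤ (θ * D) ^ 2 := by gcongr
      linarith [(abs_le.1 h3).2]
    calc ∫⁻ x, ENNReal.ofReal (Real.exp (θ * a k x)) ∂M.edgeLaw hM e
        ≤ ∫⁻ x, ENNReal.ofReal (θ * a k x + (1 + (θ * D) ^ 2)) ∂M.edgeLaw hM e :=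
          lintegral_mono fun x => ENNReal.ofReal_le_ofReal (hpt x)
      _ = ENNReal.ofReal (∫ x, (θ * a k x + (1 + (θ * D) ^ 2)) ∂M.edgeLaw hM e) :=
          (ofReal_integral_eq_lintegral_ofReal (hint.add (integrable_const _))
            (ae_of_all _ fun x => (Real.exp_pos _).le.trans (hpt x))).symm
      _ ≤ _ := by
          refine ENNReal.ofReal_le_ofReal ?_
          rw [integral_add hint (integrable_const _), integral_const_mul]
          simp only [integral_const, probReal_univ, one_smul]
          have := Real.add_one_le_exp (θ * (c₀ * k) + (θ * D) ^ 2)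
          have := mul_le_mul_of_nonneg_left (hlt e).le hθ0.le
          linarith
  set r : ℝ := Real.exp (θ * (c₀ * k) + (θ * D) ^ 2 - θ * (c₁ * k)) with hr
  have hr1 : r < 1 := by
    rw [hr, Real.exp_lt_one_iff]
    have := mul_lt_mul_of_pos_left hθ2 hθ0
    nlinarith
  have hbound : ∀ m : ℕ, M.edgeLaw hM e {x | c₁ * (m * k) ≤ a (m * k) x} ≤
      ENNReal.ofReal (Real.exp (θ * C) * r ^ m) := by
    intro m
    have hmeas : Measurable fun x => ENNReal.ofReal (Real.exp (θ * a (m * k) x)) := by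
      have := ha.measurable (m * k)
      fun_prop
    have hpos : 0 < Real.exp (θ * (c₁ * (m * k))) := Real.exp_pos _
    calc M.edgeLaw hM e {x | c₁ * (m * k) ≤ a (m * k) x}
        ≤ M.edgeLaw hM e {x | ENNReal.ofReal (Real.exp (θ * (c₁ * (m * k)))) ≤
            ENNReal.ofReal (Real.exp (θ * a (m * k) x))} :=
          measure_mono fun x hx => ENNReal.ofReal_le_ofReal
            (Real.exp_le_exp.2 (mul_le_mul_of_nonneg_left hx hθ0.le))
      _ ≤ (∫⁻ x, ENNReal.ofReal (Real.exp (θ * a (m * k) x)) ∂M.edgeLaw hM e) /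
            ENNReal.ofReal (Real.exp (θ * (c₁ * (m * k)))) :=
          meas_ge_le_lintegral_div hmeas.aemeasurable (by simpa using hpos) ENNReal.ofReal_ne_top
      _ ≤ (ENNReal.ofReal (Real.exp (θ * C)) *
            ENNReal.ofReal (Real.exp (θ * (c₀ * k) + (θ * D) ^ 2)) ^ m) /
            ENNReal.ofReal (Real.exp (θ * (c₁ * (m * k)))) :=
          ENNReal.div_le_div_right (M.lintegral_exp_le hM ha hθ0.le hρ m e) _
      _ = _ := by
          rw [← ENNReal.ofReal_pow (Real.exp_pos _).le, ← ENNReal.ofReal_mul (Real.exp_pos _).le,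
            ← ENNReal.ofReal_div_of_pos hpos, hr, ← Real.exp_nat_mul, ← Real.exp_nat_mul,
            ← Real.exp_add, ← Real.exp_add, ← Real.exp_sub]
          congr 2
          ring
  have hsum : ∑' m : ℕ, M.edgeLaw hM e {x | c₁ * (m * k) ≤ a (m * k) x} ≠ ∞ :=
    ne_top_of_le_ne_top
      ((summable_geometric_of_lt_one (Real.exp_pos _).le hr1).mul_left _).tsum_ofReal_ne_top
      (ENNReal.tsum_le_tsum hbound)
  -- Borel–Cantelli along multiples of `k`; the remainder `n % k` then contributes at most `D`.
  filter_upwards [ae_eventually_notMem hsum] with x hx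
  have hdiv : Tendsto (fun n : ℕ => n / k) atTop atTop := Nat.tendsto_div_const_atTop (by omega)
  filter_upwards [hdiv.eventually hx, eventually_ge_atTop ⌈D / (c - c₁)⌉₊] with n hn hnD
  simp only [not_le] at hn
  have h1 := ha.subadd (n / k * k) (n % k) x
  rw [Nat.div_add_mod'] at h1
  have h2 := ha.le (n % k) (seqShift (n / k * k) x)
  have h3 : C * (((n % k : ℕ) : ℝ) + 1) ≤ D := by
    rw [hD]
    have : ((n % k : ℕ) : ℝ) ≤ k := by exact_mod_cast (Nat.mod_lt n hk).le
    gcongr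
  have h4 : ((n / k : ℕ) : ℝ) * k ≤ n := by exact_mod_cast Nat.div_mul_le_self n k
  have h5 := mul_le_mul_of_nonneg_left h4 h0
  have h6 := (div_le_iff₀ (sub_pos.2 hc₁c)).1 (Nat.ceil_le.1 hnD)
  linarith

/-- If the cocycle almost surely has a block of slope at most `c`, then the growth rate is at most
`c`. -/
theorem growthRate_le_of_ae {c : ℝ}
    (h : ∀ e, ∀ᵐ x ∂M.edgeLaw hM e, ∃ n : ℕ, 1 ≤ n ∧ a n x ≤ c * n) : M.growthRate hM a ≤ c := by
  have hC := ha.pos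
  have hc : 0 ≤ c := by
    obtain ⟨e⟩ := hM.edge_nonempty
    obtain ⟨x, n, hn, hx⟩ := (h e).exists
    have hn' : (0 : ℝ) < n := by exact_mod_cast hn
    exact nonneg_of_mul_nonneg_left ((ha.nonneg n x).trans hx) hn'
  -- Sequences with no good initial block of length at most `L`; these sets decrease to a null set.
  let B : ℕ → Set (ℕ → E) := fun L => {y | ∀ m : ℕ, 1 ≤ m → m ≤ L → c * m < a m y}
  have hBm : ∀ L, MeasurableSet (B L) := fun L => by
    simp only [B, Set.ofPred_forall]
    exact .iInter fun m => .iInter fun _ => .iInter fun _ =>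
      measurableSet_lt measurable_const (ha.measurable m)
  have hB0 : ∀ e, Tendsto (fun L => M.edgeLaw hM e (B L)) atTop (𝓝 0) := by
    intro e
    have hanti : Antitone B := fun L L' hL y hy m h1 h2 => hy m h1 (h2.trans hL)
    have := tendsto_measure_iInter_atTop (μ := M.edgeLaw hM e)
      (fun L => (hBm L).nullMeasurableSet) hanti ⟨0, measure_ne_top _ _⟩
    have hnull : M.edgeLaw hM e (⋂ L, B L) = 0 := by
      refine measure_eq_zero_iff_ae_notMem.2 ?_
      filter_upwards [h e] with x ⟨n, hn, hx⟩ hxB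
      exact (Set.mem_iInter.1 hxB n n hn le_rfl).not_ge hx
    rwa [hnull] at this
  have hmain : ∀ ε : ℝ, 0 < ε → M.growthRate hM a ≤ c + 2 * C * ε := by
    intro ε hε
    -- Finiteness of `E` gives one `L` for all edges, so by the Markov property each position is bad
    -- with probability at most `ε`.
    obtain ⟨L, hL⟩ : ∃ L, ∀ e, M.edgeLaw hM e (B L) ≤ ENNReal.ofReal ε := by
      have : ∀ᶠ L in atTop, ∀ e, M.edgeLaw hM e (B L) ≤ ENNReal.ofReal ε :=
        eventually_all.2 fun e => (hB0 e).eventually_le_const (ENNReal.ofReal_pos.2 hε)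
      exact this.exists
    have hshift : ∀ e i, (M.edgeLaw hM e).real (seqShift i ⁻¹' B L) ≤ ε := by
      intro e i
      have := M.lintegral_mul_comp_seqShift_le hM i (G := fun _ => 1)
        (fun _ _ _ => rfl) (measurable_one.indicator (hBm L))
        (fun f => (lintegral_indicator_one (hBm L)).trans_le (hL f)) e
      simp only [one_mul, lintegral_const, measure_univ] at this
      refine ENNReal.toReal_le_of_le_ofReal hε.le (le_trans (le_of_eq ?_) this)
      rw [← lintegral_indicator_one (measurable_seqShift i (hBm L))]
      rfl
    have hn : ∀ n : ℕ, 1 ≤ n → M.growthRate hM a * n ≤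
        c * n + 2 * C * (n * ε) + C * (L + 1) := by
      intro n hn
      refine M.growthRate_mul_le hM ha hn fun e => ?_
      have hint : ∀ i, Integrable (fun x => (B L).indicator (1 : (ℕ → E) → ℝ) (seqShift i x))
          (M.edgeLaw hM e) := fun i =>
        (integrable_const (1 : ℝ)).indicator (measurable_seqShift i (hBm L))
      have hval : ∀ i, ∫ x, (B L).indicator (1 : (ℕ → E) → ℝ) (seqShift i x) ∂M.edgeLaw hM e =
          (M.edgeLaw hM e).real (seqShift i ⁻¹' B L) := fun i =>
        integral_indicator_one (measurable_seqShift i (hBm L))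
      have hsumint := integrable_finsetSum (Finset.range n) fun i _ => hint i
      calc ∫ x, a n x ∂M.edgeLaw hM e
          ≤ ∫ x, (c * n + 2 * C * ∑ i ∈ Finset.range n,
              (B L).indicator (1 : (ℕ → E) → ℝ) (seqShift i x) + C * (L + 1))
              ∂M.edgeLaw hM e :=
            integral_mono (ha.integrable _ n)
              (((integrable_const _).add (hsumint.const_mul _)).add (integrable_const _))
              (ha.le_of_blocks hc L n)
        _ = c * n + 2 * C * ∑ i ∈ Finset.range n,
              (M.edgeLaw hM e).real (seqShift i ⁻¹' B L) + C * (L + 1) := by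
            have h1 : Integrable (fun x => c * (n : ℝ) + 2 * C * ∑ i ∈ Finset.range n,
                (B L).indicator (1 : (ℕ → E) → ℝ) (seqShift i x)) (M.edgeLaw hM e) :=
              (integrable_const _).add (hsumint.const_mul _)
            rw [integral_add h1 (integrable_const _),
              integral_add (integrable_const _) (hsumint.const_mul _),
              integral_const_mul (2 * C), integral_finsetSum _ fun i _ => hint i]
            simp [hval]
        _ ≤ _ := by
            have : ∑ i ∈ Finset.range n, (M.edgeLaw hM e).real (seqShift i ⁻¹' B L) ≤ n * ε :=
              (Finset.sum_le_sum fun i _ => hshift e i).trans_eq (by simp)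
            gcongr
    -- With `L` fixed, `C * (L + 1)` is negligible against `n`.
    by_contra! hlt
    obtain ⟨n, hn1⟩ := exists_nat_gt (C * (L + 1) / (M.growthRate hM a - (c + 2 * C * ε)))
    have hpos := sub_pos.2 hlt
    have h1 := (div_lt_iff₀ hpos).1 hn1
    have h2 : 1 ≤ n := by
      have : (0 : ℝ) < n := lt_of_le_of_lt (by positivity) hn1
      exact_mod_cast this
    have := hn n h2
    linarith
  refine le_of_forall_pos_le_add fun ε hε => ?_
  have := hmain (ε / (2 * C)) (by positivity)
  rwa [mul_div_cancel₀ _ (by positivity)] at this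

/-- Lower bound: almost surely the cocycle eventually grows with slope at least any number below the
growth rate. -/
theorem ae_eventually_ge {c : ℝ} (hc : c < M.growthRate hM a) (e : E) :
    ∀ᵐ x ∂M.edgeLaw hM e, ∀ᶠ n : ℕ in atTop, c * n ≤ a n x := by
  obtain ⟨c', hc', hlt⟩ := exists_between hc
  let S : Set (ℕ → E) := {x | ∃ q : ℚ, (q : ℝ) < c' ∧ ∃ᶠ n : ℕ in atTop, a n x < q * n}
  have hS : MeasurableSet S := by
    simp only [S, frequently_atTop, Set.ofPred_exists, Set.ofPred_and, Set.ofPred_forall]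
    exact .iUnion fun q => (MeasurableSet.const _).inter <| .iInter fun N => .iUnion fun n =>
      (MeasurableSet.const _).inter (measurableSet_lt (ha.measurable n) measurable_const)
  -- The null case is the claim; the full case would give `growthRate ≤ c'`, contrary to the choice
  -- of `c'`.
  rcases M.edgeLaw_zero_or_one hM hS (ha.seqShift_mem_iff c') with h | h
  · filter_upwards [measure_eq_zero_iff_ae_notMem.1 (h e)] with x hx
    obtain ⟨q, hcq, hq⟩ := exists_rat_btwn hc'
    have : ¬∃ᶠ n : ℕ in atTop, a n x < q * n := fun hf => hx ⟨q, hq, hf⟩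
    filter_upwards [not_frequently.1 this] with n hn
    exact (mul_le_mul_of_nonneg_right hcq.le (Nat.cast_nonneg n)).trans (not_lt.1 hn)
  · refine absurd (M.growthRate_le_of_ae hM ha fun e => ?_) hlt.not_ge
    filter_upwards [(mem_ae_iff_prob_eq_one hS).2 (h e)] with x hx
    obtain ⟨q, hq, hf⟩ := hx
    obtain ⟨n, hn, hn1⟩ := (hf.and_eventually (eventually_ge_atTop 1)).exists
    exact ⟨n, hn1, hn.le.trans (mul_le_mul_of_nonneg_right hq.le (Nat.cast_nonneg n))⟩

/-- The subadditive ergodic theorem for the Markov chain on the edges. -/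
theorem ae_tendsto_growthRate (e : E) : ∀ᵐ x ∂M.edgeLaw hM e,
    Tendsto (fun n : ℕ => a n x / n) atTop (𝓝 (M.growthRate hM a)) := by
  have hu : ∀ᵐ x ∂M.edgeLaw hM e, ∀ j : ℕ, ∀ᶠ n : ℕ in atTop,
      a n x ≤ (M.growthRate hM a + 1 / ((j : ℝ) + 1)) * n :=
    ae_all_iff.2 fun j => M.ae_eventually_le hM ha
      (lt_add_of_pos_right _ Nat.one_div_pos_of_nat) e
  have hl : ∀ᵐ x ∂M.edgeLaw hM e, ∀ j : ℕ, ∀ᶠ n : ℕ in atTop,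
      (M.growthRate hM a - 1 / ((j : ℝ) + 1)) * n ≤ a n x :=
    ae_all_iff.2 fun j => M.ae_eventually_ge hM ha
      (sub_lt_self _ Nat.one_div_pos_of_nat) e
  filter_upwards [hu, hl] with x hux hlx
  rw [Metric.tendsto_atTop']
  intro ε hε
  obtain ⟨j, hj⟩ := exists_nat_one_div_lt hε
  obtain ⟨N, hN⟩ := eventually_atTop.1 ((hux j).and (hlx j))
  refine ⟨N, fun n hn => ?_⟩
  obtain ⟨h1, h2⟩ := hN n hn.le
  have hn0 : (0 : ℝ) < n := by exact_mod_cast (Nat.zero_le N).trans_lt hn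
  have h3 := (div_le_iff₀ hn0).2 h1
  have h4 := (le_div_iff₀ hn0).2 h2
  rw [Real.dist_eq, abs_lt]
  constructor <;> linarith

end NDAutomaton

/-! ### Lengths in a group with a left-invariant semi-metric. -/

namespace IsLeftInvariantSemimetric

variable {G : Type*} [Group G] {d : G → G → ℝ} (hd : IsLeftInvariantSemimetric d)
include hd

theorem one_mul_le (g h : G) : d 1 (g * h) ≤ d 1 g + d 1 h := by
  have h1 := hd.triangle 1 g (g * h)
  have h2 := hd.left_invariant g 1 h
  rw [mul_one] at h2
  linarith

/-- The lower estimate comes from `g = (g * h) * h⁻¹`; without symmetry the lengths of `h` and `h⁻¹`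
must both appear. -/
theorem abs_one_mul_sub_le (g h : G) : |d 1 (g * h) - d 1 g| ≤ d 1 h + d 1 h⁻¹ := by
  have h1 := hd.one_mul_le g h
  have h2 := hd.one_mul_le (g * h) h⁻¹
  rw [mul_inv_cancel_right] at h2
  have h3 := hd.nonneg 1 h
  have h4 := hd.nonneg 1 h⁻¹
  rw [abs_le]
  constructor <;> linarith

end IsLeftInvariantSemimetric

/-! ### Word lengths as a cocycle. -/

namespace NDAutomaton

section

variable {A Q E : Type*} (M : NDAutomaton A Q E)

/-- The label of the first `n` terms of a sequence of edges. -/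
def seqWord (n : ℕ) (x : ℕ → E) : FreeMonoid A :=
  FreeMonoid.ofList (List.ofFn fun i : Fin n => M.label (x i))

/-- The state after the first `n` terms of a sequence of edges. -/
def seqEndState (n : ℕ) (x : ℕ → E) : Q :=
  match n with
  | 0 => M.origin (x 0)
  | k + 1 => M.terminus (x k)

theorem endState_eq (n : ℕ) (ω : M.PathSpace) : M.endState n ω = M.seqEndState n ω.1 := by
  cases n <;> rfl

theorem seqWord_add (m n : ℕ) (x : ℕ → E) :
    M.seqWord (m + n) x = M.seqWord m x * M.seqWord n (seqShift m x) := by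
  simp only [seqWord, seqShift, ← FreeMonoid.ofList_append, List.ofFn_add]
  congr 3
  funext i
  exact congrArg (fun j => M.label (x j)) (add_comm m i)

theorem seqWord_one (x : ℕ → E) : M.seqWord 1 x = FreeMonoid.of (M.label (x 0)) := rfl

theorem dependsOn_seqWord (n : ℕ) : DependsOn (M.seqWord n) (Set.Iio n) := by
  intro x y h
  simp only [seqWord]
  congr 2
  funext i
  rw [h i i.2]

/-- The bound is `n + 1` because at `n = 0` the state is read off the first edge. -/
theorem dependsOn_seqEndState (n : ℕ) : DependsOn (M.seqEndState n) (Set.Iio (n + 1)) := by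
  intro x y h
  cases n with
  | zero => exact congrArg M.origin (h 0 (Nat.zero_lt_one))
  | succ n => exact congrArg M.terminus (h n (by simp only [Set.mem_Iio]; omega))

/-- The lengths of the images of the labels of the initial segments form a subadditive cocycle. -/
theorem exists_isSubadditiveCocycle [Finite E] {G : Type*} [Group G] (φ : FreeMonoid A →* G)
    {d : G → G → ℝ} (hd : IsLeftInvariantSemimetric d) :
    ∃ C, IsSubadditiveCocycle (fun n x => d 1 (φ (M.seqWord n x))) C := by
  obtain ⟨K, hK⟩ := (Set.finite_range fun e => d 1 (φ (FreeMonoid.of (M.label e))) +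
    d 1 (φ (FreeMonoid.of (M.label e)))⁻¹).bddAbove
  have hle : ∀ e, d 1 (φ (FreeMonoid.of (M.label e))) +
      d 1 (φ (FreeMonoid.of (M.label e)))⁻¹ ≤ K := fun e => hK ⟨e, rfl⟩
  have h11 := hd.nonneg 1 1
  have hsub : ∀ m n x, d 1 (φ (M.seqWord (m + n) x)) ≤
      d 1 (φ (M.seqWord m x)) + d 1 (φ (M.seqWord n (seqShift m x))) := fun m n x => by
    rw [seqWord_add, map_mul]
    exact hd.one_mul_le _ _
  have hC1 : ∀ e, d 1 (φ (FreeMonoid.of (M.label e))) ≤ |K| + d 1 1 + 1 := fun e => by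
    linarith [hle e, le_abs_self K, hd.nonneg 1 (φ (FreeMonoid.of (M.label e)))⁻¹]
  have hC2 : ∀ e, d 1 (φ (FreeMonoid.of (M.label e)))⁻¹ ≤ |K| + d 1 1 + 1 := fun e => by
    linarith [hle e, le_abs_self K, hd.nonneg 1 (φ (FreeMonoid.of (M.label e)))]
  -- `|K|` covers the letters and their inverses, `d 1 1` the empty word, and `1` gives positivity.
  refine ⟨|K| + d 1 1 + 1, by positivity, fun _ _ => hd.nonneg _ _, hsub, fun n x y h => ?_,
    fun n x => ?_, fun n x => ?_⟩
  · simp only [M.dependsOn_seqWord n h]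
  · induction n with
    | zero =>
      have : M.seqWord 0 x = 1 := rfl
      simp only [this, map_one]
      have := abs_nonneg K
      simp only [Nat.cast_zero]
      linarith
    | succ n ih =>
      have h1 := hsub n 1 x
      rw [seqWord_one] at h1
      have h2 := hC1 (seqShift n x 0)
      push_cast
      linarith
  -- The first letter is removed by left multiplication with its inverse in `G`.
  · have h1 := hd.one_mul_le (φ (FreeMonoid.of (M.label (x 0))))⁻¹ (φ (M.seqWord (n + 1) x))
    rw [add_comm n 1, seqWord_add, seqWord_one, map_mul, inv_mul_cancel_left] at h1
    have h2 := hC2 (x 0)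
    simp only [add_comm n 1, seqWord_add, seqWord_one, map_mul]
    linarith

end

/-! ### Transfer to the path space and the main theorem. -/

variable {A Q E : Type*} [Fintype E] [MeasurableSpace E] [DiscreteMeasurableSpace E]
    (M : NDAutomaton A Q E) (hM : M.IsNormal)

theorem ae_pathMeasure_of_edgeLaw {p : (ℕ → E) → Prop} (h : ∀ e, ∀ᵐ x ∂M.edgeLaw hM e, p x)
    (μ : PMF E) : ∀ᵐ ω ∂M.pathMeasure hM μ, p ω.1 := by
  refine ae_of_ae_map measurable_subtype_coe.aemeasurable ?_
  rw [M.map_pathMeasure hM μ, chainLaw_eq_sum, ae_iff]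
  simp only [Measure.coe_finsetSum, Finset.sum_apply, Measure.smul_apply, smul_eq_mul]
  exact Finset.sum_eq_zero fun e _ => by rw [ae_iff.1 (h e), mul_zero]

/-- Convergence almost surely and in `L¹` for a process at bounded distance from a subadditive
cocycle. -/
theorem tendsto_pathMeasure {a g : ℕ → (ℕ → E) → ℝ} {C K : ℝ} (ha : IsSubadditiveCocycle a C)
    (hg : ∀ n, Measurable (g n)) (hK : ∀ n x, |g n x - a n x| ≤ K) (μ : PMF E) :
    (∀ᵐ ω ∂M.pathMeasure hM μ,
      Tendsto (fun n : ℕ => g n ω.1 / n) atTop (𝓝 (M.growthRate hM a))) ∧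
    (∀ n : ℕ, MemLp (fun ω : M.PathSpace => g n ω.1 / n) 1 (M.pathMeasure hM μ)) ∧
    Tendsto (fun n : ℕ => eLpNorm (fun ω : M.PathSpace => g n ω.1 / n - M.growthRate hM a) 1
      (M.pathMeasure hM μ)) atTop (𝓝 0) := by
  have hC := ha.pos
  have hmeas : ∀ n : ℕ, Measurable fun ω : M.PathSpace => g n ω.1 / n := fun n =>
    ((hg n).comp measurable_subtype_coe).div_const _
  -- This uniform bound is the dominating constant for `L¹` convergence; at `n = 0` the quotient is
  -- `0` by convention.
  have hbound : ∀ (n : ℕ) x, |g n x / n| ≤ 2 * C + |K| := by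
    intro n x
    rcases Nat.eq_zero_or_pos n with rfl | hn
    · simp only [Nat.cast_zero, div_zero, abs_zero]
      positivity
    · have hn1 : (1 : ℝ) ≤ n := by exact_mod_cast hn
      rw [abs_div, Nat.abs_cast, div_le_iff₀ (by positivity)]
      have h1 := ha.nonneg n x
      have h2 := ha.le n x
      have h3 := abs_le.1 ((hK n x).trans (le_abs_self K))
      have h4 : |K| * 1 ≤ |K| * n := mul_le_mul_of_nonneg_left hn1 (abs_nonneg K)
      have h5 : C * 1 ≤ C * n := mul_le_mul_of_nonneg_left hn1 hC.le
      rw [abs_le]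
      constructor <;> nlinarith
  have hae : ∀ᵐ ω ∂M.pathMeasure hM μ,
      Tendsto (fun n : ℕ => g n ω.1 / n) atTop (𝓝 (M.growthRate hM a)) := by
    refine M.ae_pathMeasure_of_edgeLaw hM
      (p := fun x => Tendsto (fun n : ℕ => g n x / n) atTop (𝓝 (M.growthRate hM a)))
      (fun e => ?_) μ
    filter_upwards [M.ae_tendsto_growthRate hM ha e] with x hx
    have hdiff : Tendsto (fun n : ℕ => (g n x - a n x) / n) atTop (𝓝 0) := by
      refine squeeze_zero_norm (fun n => ?_) (tendsto_const_div_atTop_nhds_zero_nat K)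
      rw [norm_div, Real.norm_eq_abs, Real.norm_natCast]
      exact div_le_div_of_nonneg_right (hK n x) (Nat.cast_nonneg n)
    have := hx.add hdiff
    rw [add_zero] at this
    exact this.congr fun n => by ring
  refine ⟨hae, fun n => ?_, ?_⟩
  · exact .of_bound (hmeas n).aestronglyMeasurable (2 * C + |K|) (ae_of_all _ fun ω => hbound n ω.1)
  · simp only [eLpNorm_one_eq_lintegral_enorm]
    rw [show (0 : ℝ≥0∞) = ∫⁻ _, 0 ∂M.pathMeasure hM μ from lintegral_zero.symm]
    refine tendsto_lintegral_of_dominated_convergence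
      (fun _ => ENNReal.ofReal (2 * C + |K| + |M.growthRate hM a|))
      (fun n => ((hmeas n).sub_const _).enorm) (fun n => ae_of_all _ fun ω => ?_) (by simp) ?_
    · simp only [Real.enorm_eq_ofReal_abs]
      exact ENNReal.ofReal_le_ofReal ((abs_sub _ _).trans (by gcongr; exact hbound n ω.1))
    · filter_upwards [hae] with ω hω
      have := (hω.sub_const (M.growthRate hM a)).enorm
      simpa using this

end NDAutomaton

theorem mainTheorem7 {A Q E G : Type*} [Finite A] [Finite Q] [Fintype E]
    [MeasurableSpace E] [DiscreteMeasurableSpace E] [Group G]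
    (M : NDAutomaton A Q E) (hM : M.IsNormal)
    (φ : FreeMonoid A →* G) (d : G → G → ℝ) (hd : IsLeftInvariantSemimetric d) :
    ∃ lam : ℝ, 0 ≤ lam ∧
      ∀ μ : PMF E,
        ((∀ᵐ ω ∂M.pathMeasure hM μ,
            Tendsto (fun n : ℕ => d 1 (φ (M.word n ω)) / n) atTop (𝓝 lam)) ∧
          (∀ n : ℕ, MemLp (fun ω => d 1 (φ (M.word n ω)) / n) 1 (M.pathMeasure hM μ)) ∧
          Tendsto (fun n : ℕ =>
            eLpNorm (fun ω => d 1 (φ (M.word n ω)) / n - lam) 1 (M.pathMeasure hM μ))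
            atTop (𝓝 0)) ∧
        ∀ u : Q → FreeMonoid A, (∀ q, M.IsShortestAcceptLabel q (u q)) →
          (∀ᵐ ω ∂M.pathMeasure hM μ,
            Tendsto (fun n : ℕ => d 1 (φ (M.extendedWord u n ω)) / n) atTop (𝓝 lam)) ∧
          (∀ n : ℕ, MemLp (fun ω => d 1 (φ (M.extendedWord u n ω)) / n) 1
            (M.pathMeasure hM μ)) ∧
          Tendsto (fun n : ℕ =>
            eLpNorm (fun ω => d 1 (φ (M.extendedWord u n ω)) / n - lam) 1
              (M.pathMeasure hM μ))
            atTop (𝓝 0) := by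

  obtain ⟨C, ha⟩ := M.exists_isSubadditiveCocycle φ hd
  refine ⟨M.growthRate hM _, M.growthRate_nonneg hM ha, fun μ => ⟨?_, fun u _ => ?_⟩⟩
  · exact M.tendsto_pathMeasure hM ha (K := 0) ha.measurable (fun n x => by simp) μ
  -- There are finitely many words `u q`, so appending them perturbs the cocycle by at most a
  -- constant.
  · obtain ⟨K, hK⟩ := (Set.finite_range fun q => d 1 (φ (u q)) + d 1 (φ (u q))⁻¹).bddAbove
    have := M.tendsto_pathMeasure hM ha (K := K)
      (g := fun n x => d 1 (φ (M.seqWord n x * u (M.seqEndState n x))))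
      (fun n => measurable_of_dependsOn (n := n + 1) fun x y h => by
        simp only [M.dependsOn_seqEndState n h,
          M.dependsOn_seqWord n fun i hi => h i (Nat.lt_succ_of_lt hi)])
      (fun n x => by
        rw [map_mul]
        exact (hd.abs_one_mul_sub_le _ _).trans (hK ⟨M.seqEndState n x, rfl⟩)) μ
    simp only [NDAutomaton.extendedWord, M.endState_eq]
    exact this
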